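/- Let $X$ be a metric space of bounded geometry, i.e. for every $R>0$ there is $N_R\in\mathbb N$ such that every closed ball $B(x;R)=\{y\in X: d(x,y)\le R\}$ has at most $N_R$ points. If $X$ has the operator norm localisation property (ONL), then $X$ has uniform local amenability (ULA). Here the two properties are defined as follows. **ONL.** For a probability measure $\mu$ on (all subsets of) $X$ and a nonzero separable complex Hilbert space $\mathcal H$, let $l^2(X,\mu,\mathcal H)$ be the Hilbert space of functions $\phi:X\to\mathcal H$ with $\|\phi\|^2=\sum_{x}\mu(x)\|\phi(x)\|^2<\infty$, modulo functions of norm zero; the support of (the class of) $\phi$ is $\{x:\mu(x)\neq 0,\ \phi(x)\ne 0\}$. Let $\mathbb C_R[X;\mu,\mathcal H]$ be the set of bounded operators $T=(T_{x,y})$ on $l^2(X,\mu,\mathcal H)$ whose matrix entries satisfy $T_{x,y}=0$ whenever $d(x,y)>R$. Then $X$ has ONL if there is $c>0$ such that for every $R>0$ there is $S>0$ such that for every such $\mu$ and $\mathcal H$ and every $T\in\mathbb C_R[X;\mu,\mathcal H]$ there is a unit vector $\phi\in l^2(X,\mu,\mathcal H)$ with $\operatorname{diam}(\operatorname{supp}\phi)\le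 S$ and $\|T\phi\|\ge c\|T\|$. **ULA.** For all $R,\epsilon>0$ there is $S>0$ such that for every nonempty finite $F\subseteq X$ there is $\phi\in l^1(X)$ with $\operatorname{diam}(\operatorname{supp}\phi)\le S$ and $$\sum_{x\in F}\ \sum_{y\in F,\ d(x,y)\le R}|\phi(x)-\phi(y)|<\epsilon\sum_{x\in F}|\phi(x)|;$$ and also (an equivalent property for bounded geometry spaces) for all $R,\epsilon>0$ there is $S>0$ such that for every nonempty finite $F\subseteq X$ there is a finite set $E\subseteq X$ with $\operatorname{diam}(E)\le S$ and $|\partial_RE\cap F|<\epsilon|E\cap F|$, where $\partial_RE=\{y\in X: d(y,E)\le R\}\setminus E$. -/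

import Mathlib

open MeasureTheory
open scoped ENNReal

noncomputable section

namespace CoarseGeometry

/-- Bounded geometry: closed balls of a given radius have uniformly bounded (finite)
cardinality. -/
def BoundedGeometry (X : Type*) [MetricSpace X] : Prop :=
  ∀ R : ℝ, 0 < R → ∃ N : ℕ, ∀ x : X, (Metric.closedBall x R).encard ≤ N

/-- The `R`-boundary `∂_R E = N_R(E) \ E`, where `N_R(E) = {y | d(y, E) ≤ R}`. It is empty when
`E` is empty. -/
def boundary {X : Type*} [MetricSpace X] (R : ℝ) (E : Set X) : Set X :=
  Metric.cthickening R E \ E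

/-- Uniform local amenability, formulated with functions in `l¹(X)`. Diameters are taken in
`[0, ∞]`, so that a set of diameter at most `S` is really bounded. -/
def ULAFunction (X : Type*) [MetricSpace X] : Prop :=
  ∀ R ε : ℝ, 0 < R → 0 < ε → ∃ S : ℝ, 0 < S ∧
    ∀ F : Finset X, F.Nonempty →
      ∃ φ : lp (fun _ : X => ℝ) 1,
        Metric.ediam (Function.support (φ : X → ℝ)) ≤ ENNReal.ofReal S ∧
        ∑ x ∈ F, ∑ y ∈ F with dist x y ≤ R, |φ x - φ y| < ε * ∑ x ∈ F, |φ x|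

/-- Uniform local amenability, formulated with finite sets. -/
def ULASet (X : Type*) [MetricSpace X] : Prop :=
  ∀ R ε : ℝ, 0 < R → 0 < ε → ∃ S : ℝ, 0 < S ∧
    ∀ F : Finset X, F.Nonempty →
      ∃ E : Set X, E.Finite ∧ Metric.ediam E ≤ ENNReal.ofReal S ∧
        ((boundary R E ∩ F).ncard : ℝ) < ε * ((E ∩ F).ncard : ℝ)

/-- The property ULA, in both of its formulations. -/
def ULA (X : Type*) [MetricSpace X] : Prop :=
  ULAFunction X ∧ ULASet X

section Operators

variable {X : Type*} [MeasurableSpace X] [DiscreteMeasurableSpace X]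
variable {H : Type*} [NormedAddCommGroup H] [InnerProductSpace ℂ H]

/-- The support of an element `φ` of `l²(X, μ, H) = Lp H 2 μ`: the points of positive mass at
which `φ` does not vanish. Values at points of mass zero are meaningless. -/
def l2Support {μ : Measure X} (φ : Lp H 2 μ) : Set X :=
  {x | μ {x} ≠ 0 ∧ φ x ≠ 0}

/-- The function with value `v` at `y` and `0` elsewhere, as an element of `l²(X, μ, H)`. -/
def single (μ : Measure X) [IsFiniteMeasure μ] (y : X) (v : H) : Lp H 2 μ :=
  indicatorConstLp 2 (measurableSet_singleton y) (measure_ne_top μ {y}) v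

/-- The matrix entry `T_{x,y} : H → H` of a bounded operator on `l²(X, μ, H)`; it is meaningful
for points `x`, `y` of positive mass. -/
def matrixEntry {μ : Measure X} [IsFiniteMeasure μ] (T : Lp H 2 μ →L[ℂ] Lp H 2 μ)
    (x y : X) (v : H) : H :=
  T (single μ y v) x

end Operators

/-- Membership in `ℂ_R[X; μ, H]`: the matrix entries `T_{x,y}` vanish whenever `d(x, y) > R`. -/
def HasPropagation {X : Type*} [MetricSpace X] [MeasurableSpace X] [DiscreteMeasurableSpace X]
    {H : Type*} [NormedAddCommGroup H] [InnerProductSpace ℂ H]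
    {μ : Measure X} [IsFiniteMeasure μ] (R : ℝ) (T : Lp H 2 μ →L[ℂ] Lp H 2 μ) : Prop :=
  ∀ x y : X, μ {x} ≠ 0 → μ {y} ≠ 0 → R < dist x y → ∀ v : H, matrixEntry T x y v = 0

/-- The operator norm localisation property. Measures are defined on all subsets of `X`. The
Hilbert spaces are nonzero (otherwise there are no unit vectors); every separable Hilbert space
has an isometric copy in `Type`. -/
def ONL (X : Type*) [MetricSpace X] : Prop :=
  letI : MeasurableSpace X := ⊤
  ∃ c : ℝ, 0 < c ∧ ∀ R : ℝ, 0 < R → ∃ S : ℝ, 0 < S ∧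
    ∀ (μ : Measure X) [IsProbabilityMeasure μ]
      (H : Type) [NormedAddCommGroup H] [InnerProductSpace ℂ H] [CompleteSpace H]
      [TopologicalSpace.SeparableSpace H] [Nontrivial H]
      (T : Lp H 2 μ →L[ℂ] Lp H 2 μ), HasPropagation R T →
      ∃ φ : Lp H 2 μ, ‖φ‖ = 1 ∧
        Metric.ediam (l2Support φ) ≤ ENNReal.ofReal S ∧ c * ‖T‖ ≤ ‖T φ‖

end CoarseGeometry

end

/-! Given a finite `F`, ONL is applied to the uniform measure on `F`, `H = ℂ` and powers of `A = 1 -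
L/(2M)`, where `L` is the Laplacian of the graph joining points of `F` at distance at most `R` and
`M` bounds its degrees. Constants are fixed by `A`, so `‖A ^ n‖ ≥ 1`, while `A ^ n` spreads supports
by at most `n * R`.

The ONL constant does not depend on the propagation, so `n` may be chosen after it, and
independently of `F`. A localised `v` whose norm survives `A ^ n` up to that constant must then have
a step `ψ = A ^ k v` with `k < n` at which almost nothing is lost (`exists_lt_of_pow_lt`). Each step
loses at least `energy R ψ / (4 * M)` of the squared norm (`sum_norm_sq_averaging_le`), so `ψ` has
small energy (`exists_energy_le`). Then `‖ψ‖ ^ 2` varies little in `l¹` (`exists_variation_lt`),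
which is the function form of ULA; some superlevel set of it gives the set form
(`exists_superlevel_boundary_lt`). -/

namespace CoarseGeometry

/-! ### Averaging operators and Dirichlet energy on a finite metric space -/

section Averaging

variable {Y : Type*} [Fintype Y] [MetricSpace Y]

/-- The lazy averaging operator `1 - K⁻¹ L`, where `L` is the Laplacian of the graph on `Y` whose
edges are the pairs of points at distance at most `R`. -/
noncomputable def averaging (R K : ℝ) : (Y → ℂ) →ₗ[ℂ] (Y → ℂ) where
  toFun v x := v x - K⁻¹ • ∑ y with dist x y ≤ R, (v x - v y)
  map_add' v w := by
    ext x
    simp only [Pi.add_apply, add_sub_add_comm, Finset.sum_add_distrib, smul_add]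
  map_smul' a v := by
    ext x
    simp only [Pi.smul_apply, RingHom.id_apply, smul_sub a, Finset.smul_sum, smul_comm a]

/-- The Dirichlet energy of `v` for the graph of pairs at distance at most `R`. -/
noncomputable def energy (R : ℝ) (v : Y → ℂ) : ℝ :=
  ∑ x, ∑ y with dist x y ≤ R, ‖v x - v y‖ ^ 2

theorem averaging_apply (R K : ℝ) (v : Y → ℂ) (x : Y) :
    averaging R K v x = v x - K⁻¹ • ∑ y with dist x y ≤ R, (v x - v y) := rfl

theorem averaging_const (R K : ℝ) : averaging R K (fun _ : Y => (1 : ℂ)) = fun _ => 1 := by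
  ext x
  simp [averaging_apply]

theorem averaging_pow_const (R K : ℝ) (n : ℕ) :
    (averaging R K ^ n) (fun _ : Y => (1 : ℂ)) = fun _ => 1 := by
  induction n with
  | zero => rfl
  | succ n ih => rw [pow_succ, Module.End.mul_apply, averaging_const, ih]

theorem exists_of_averaging_ne_zero {R K : ℝ} (hR : 0 ≤ R) {v : Y → ℂ} {x : Y}
    (h : averaging R K v x ≠ 0) : ∃ y, v y ≠ 0 ∧ dist x y ≤ R := by
  by_contra! hv
  have hx : v x = 0 := by
    by_contra h0
    exact absurd (hv x h0) (by simpa using hR)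
  refine h ?_
  rw [averaging_apply, Finset.sum_eq_zero, hx]
  · simp
  · intro y hy
    have : v y = 0 := by
      by_contra h0
      exact absurd (hv y h0) (not_lt.mpr (Finset.mem_filter.mp hy).2)
    rw [hx, this, sub_zero]

theorem exists_of_averaging_pow_ne_zero {R K : ℝ} (hR : 0 ≤ R) {v : Y → ℂ} (n : ℕ) {x : Y}
    (h : (averaging R K ^ n) v x ≠ 0) : ∃ y, v y ≠ 0 ∧ dist x y ≤ n * R := by
  induction n generalizing x with
  | zero => exact ⟨x, h, by simp⟩
  | succ n ih =>
    rw [pow_succ', Module.End.mul_apply] at h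
    obtain ⟨z, hz, hxz⟩ := exists_of_averaging_ne_zero hR h
    obtain ⟨y, hy, hzy⟩ := ih hz
    refine ⟨y, hy, (dist_triangle x z y).trans ?_⟩
    push_cast
    linarith

theorem sum_sum_filter_dist_comm (R : ℝ) (g : Y → Y → ℝ) :
    ∑ x, ∑ y with dist x y ≤ R, g x y = ∑ x, ∑ y with dist x y ≤ R, g y x := by
  simp only [Finset.sum_filter]
  rw [Finset.sum_comm]
  simp only [dist_comm]

theorem sum_sum_filter_dist_le {R : ℝ} {M : ℕ}
    (hM : ∀ x : Y, (Finset.univ.filter fun y => dist x y ≤ R).card ≤ M)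
    {g : Y → ℝ} (hg : ∀ x, 0 ≤ g x) :
    ∑ x, ∑ y with dist x y ≤ R, g x ≤ M * ∑ x, g x := by
  rw [Finset.mul_sum]
  refine Finset.sum_le_sum fun x _ => ?_
  rw [Finset.sum_const, nsmul_eq_mul]
  exact mul_le_mul_of_nonneg_right (by exact_mod_cast hM x) (hg x)

theorem energy_nonneg (R : ℝ) (v : Y → ℂ) : 0 ≤ energy R v :=
  Finset.sum_nonneg fun _ _ => Finset.sum_nonneg fun _ _ => sq_nonneg _

/-- The relation `dist x y ≤ R` is symmetric, so the terms `‖v x‖ ^ 2 - ‖v y‖ ^ 2` cancel over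
ordered pairs. -/
theorem two_mul_sum_inner_laplacian (R : ℝ) (v : Y → ℂ) :
    2 * ∑ x, inner ℝ (v x) (∑ y with dist x y ≤ R, (v x - v y)) = energy R v := by
  have key : ∀ a b : ℂ, 2 * inner ℝ a (a - b) = ‖a - b‖ ^ 2 + (‖a‖ ^ 2 - ‖b‖ ^ 2) := by
    intro a b
    rw [norm_sub_sq_real, inner_sub_right, real_inner_self_eq_norm_sq]
    ring
  simp only [inner_sum, Finset.mul_sum, key]
  simp only [Finset.sum_add_distrib, Finset.sum_sub_distrib]
  rw [sum_sum_filter_dist_comm R (fun _ y => ‖v y‖ ^ 2), sub_self, add_zero, energy]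

theorem sum_norm_sq_laplacian_le {R : ℝ} {M : ℕ}
    (hM : ∀ x : Y, (Finset.univ.filter fun y => dist x y ≤ R).card ≤ M) (v : Y → ℂ) :
    ∑ x, ‖∑ y with dist x y ≤ R, (v x - v y)‖ ^ 2 ≤ M * energy R v := by
  rw [energy, Finset.mul_sum]
  refine Finset.sum_le_sum fun x _ => ?_
  calc ‖∑ y with dist x y ≤ R, (v x - v y)‖ ^ 2
      ≤ (∑ y with dist x y ≤ R, ‖v x - v y‖) ^ 2 := by gcongr; exact norm_sum_le _ _
    _ ≤ _ := sq_sum_le_card_mul_sum_sq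
    _ ≤ _ := by
      gcongr
      exact hM x

/-- In the expanded square the cross term removes `energy / (2 * M)` and the quadratic term returns
at most half of it. -/
theorem sum_norm_sq_averaging_le {R : ℝ} {M : ℕ} (hM0 : 0 < M)
    (hM : ∀ x : Y, (Finset.univ.filter fun y => dist x y ≤ R).card ≤ M) (v : Y → ℂ) :
    ∑ x, ‖averaging R (2 * M) v x‖ ^ 2 ≤ ∑ x, ‖v x‖ ^ 2 - energy R v / (4 * M) := by
  have hM' : (0 : ℝ) < M := by exact_mod_cast hM0
  have h1 := two_mul_sum_inner_laplacian R v
  have h2 := sum_norm_sq_laplacian_le hM v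
  have hexp : ∀ x, ‖averaging R (2 * M) v x‖ ^ 2 = ‖v x‖ ^ 2
      - (2 * M : ℝ)⁻¹ * (2 * inner ℝ (v x) (∑ y with dist x y ≤ R, (v x - v y)))
      + ‖(2 * M : ℝ)⁻¹‖ ^ 2 * ‖∑ y with dist x y ≤ R, (v x - v y)‖ ^ 2 := by
    intro x
    rw [averaging_apply, norm_sub_sq_real, inner_smul_right, norm_smul, mul_pow, mul_left_comm]
  rw [Finset.sum_congr rfl fun x _ => hexp x, Finset.sum_add_distrib, Finset.sum_sub_distrib,
    ← Finset.mul_sum, ← Finset.mul_sum, ← Finset.mul_sum, h1, Real.norm_eq_abs, sq_abs]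
  have h3 : ((2 * M : ℝ)⁻¹) ^ 2 * ∑ x, ‖∑ y with dist x y ≤ R, (v x - v y)‖ ^ 2
      ≤ ((2 * M : ℝ)⁻¹) ^ 2 * (M * energy R v) := by gcongr
  have h4 : ((2 * M : ℝ)⁻¹) ^ 2 * (M * energy R v) = energy R v / (4 * M) := by
    field_simp
    ring
  have h5 : (2 * M : ℝ)⁻¹ * energy R v = 2 * (energy R v / (4 * M)) := by
    field_simp
    ring
  linarith

/-- Factor the difference of squares and apply the AM-GM inequality with a free weight `t`, to be
balanced later. -/
theorem sum_abs_norm_sq_sub_le {R t : ℝ} {M : ℕ} (ht : 0 < t)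
    (hM : ∀ x : Y, (Finset.univ.filter fun y => dist x y ≤ R).card ≤ M) (v : Y → ℂ) :
    ∑ x, ∑ y with dist x y ≤ R, |‖v x‖ ^ 2 - ‖v y‖ ^ 2|
      ≤ energy R v / (2 * t) + 2 * t * M * ∑ x, ‖v x‖ ^ 2 := by
  have key : ∀ a b : ℂ, |‖a‖ ^ 2 - ‖b‖ ^ 2|
      ≤ ‖a - b‖ ^ 2 / (2 * t) + (t * ‖a‖ ^ 2 + t * ‖b‖ ^ 2) := by
    intro a b
    have h1 : |‖a‖ ^ 2 - ‖b‖ ^ 2| ≤ ‖a - b‖ * (‖a‖ + ‖b‖) := by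
      rw [sq_sub_sq, abs_mul, mul_comm, abs_of_nonneg (by positivity : 0 ≤ ‖a‖ + ‖b‖)]
      gcongr
      exact abs_norm_sub_norm_le a b
    have h2 : ‖a - b‖ * (‖a‖ + ‖b‖) ≤ ‖a - b‖ ^ 2 / (2 * t) + t / 2 * (‖a‖ + ‖b‖) ^ 2 := by
      have : ‖a - b‖ ^ 2 / (2 * t) + t / 2 * (‖a‖ + ‖b‖) ^ 2 - ‖a - b‖ * (‖a‖ + ‖b‖)
          = (‖a - b‖ - t * (‖a‖ + ‖b‖)) ^ 2 / (2 * t) := by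
        field_simp
        ring
      have h0 : 0 ≤ (‖a - b‖ - t * (‖a‖ + ‖b‖)) ^ 2 / (2 * t) := by positivity
      linarith
    have h3 : 0 ≤ t * (‖a‖ - ‖b‖) ^ 2 := by positivity
    nlinarith
  have hsum : ∑ x, ∑ y with dist x y ≤ R, t * ‖v x‖ ^ 2 ≤ M * ∑ x, t * ‖v x‖ ^ 2 :=
    sum_sum_filter_dist_le hM (fun x => by positivity)
  calc _ ≤ ∑ x, ∑ y with dist x y ≤ R,
        (‖v x - v y‖ ^ 2 / (2 * t) + (t * ‖v x‖ ^ 2 + t * ‖v y‖ ^ 2)) :=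
        Finset.sum_le_sum fun x _ => Finset.sum_le_sum fun y _ => key _ _
    _ = energy R v / (2 * t) + (∑ x, ∑ y with dist x y ≤ R, t * ‖v x‖ ^ 2
          + ∑ x, ∑ y with dist x y ≤ R, t * ‖v x‖ ^ 2) := by
        simp only [Finset.sum_add_distrib, energy, Finset.sum_div]
        rw [sum_sum_filter_dist_comm R (fun _ y => t * ‖v y‖ ^ 2)]
    _ ≤ _ := by
        rw [← Finset.mul_sum] at hsum
        linarith

/-- Some step of an orbit that shrinks only by the factor `c` in `n` steps shrinks little. -/
theorem exists_lt_of_pow_lt {a : ℕ → ℝ} {q c : ℝ} {n : ℕ} (hq : 0 ≤ q) (hqc : q ^ n < c)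
    (ha : 0 < a 0) (hn : c * a 0 ≤ a n) : ∃ k < n, q * a k < a (k + 1) := by
  by_contra! h
  have : ∀ k ≤ n, a k ≤ q ^ k * a 0 := by
    intro k
    induction k with
    | zero => simp
    | succ k ih =>
      intro hk
      calc a (k + 1) ≤ q * a k := h k hk
        _ ≤ q * (q ^ k * a 0) := by gcongr; exact ih (by omega)
        _ = _ := by ring
  have h1 := this n le_rfl
  have h2 := mul_lt_mul_of_pos_right hqc ha
  linarith

end Averaging

/-! ### Functions on a finite set as `l²` of its uniform measure -/

section UniformMeasure

variable {X : Type*} [MeasurableSpace X]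

/-- The uniform probability measure on a finite set. -/
noncomputable def uniformMeasure (F : Finset X) : Measure X :=
  ∑ x ∈ F, (F.card : ℝ≥0∞)⁻¹ • Measure.dirac x

theorem isProbabilityMeasure_uniformMeasure {F : Finset X} (hF : F.Nonempty) :
    IsProbabilityMeasure (uniformMeasure F) := by
  constructor
  simp only [uniformMeasure, Measure.finsetSum_apply, Measure.smul_apply, measure_univ,
    smul_eq_mul, mul_one, Finset.sum_const, nsmul_eq_mul]
  exact ENNReal.mul_inv_cancel (by simpa using hF.ne_empty) (by simp)

variable [DiscreteMeasurableSpace X]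

theorem lintegral_uniformMeasure (F : Finset X) (g : X → ℝ≥0∞) :
    ∫⁻ x, g x ∂(uniformMeasure F) = (F.card : ℝ≥0∞)⁻¹ * ∑ x ∈ F, g x := by
  simp [uniformMeasure, Finset.mul_sum]

theorem uniformMeasure_singleton_ne_zero_iff {F : Finset X} {x : X} :
    uniformMeasure F {x} ≠ 0 ↔ x ∈ F := by
  classical
  simp [uniformMeasure, Measure.finsetSum_apply, Set.indicator_apply]

/-- Points of `F` are atoms, so values there do not depend on the representative. -/
theorem eq_of_ae_uniformMeasure {E : Type*} {F : Finset X} {g h : X → E}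
    (hgh : g =ᵐ[uniformMeasure F] h) {x : X} (hx : x ∈ F) : g x = h x := by
  by_contra hne
  refine uniformMeasure_singleton_ne_zero_iff.mpr hx (measure_mono_null ?_ (ae_iff.mp hgh))
  simpa using hne

theorem ae_uniformMeasure_of_forall {E : Type*} {F : Finset X} {g h : X → E}
    (hgh : ∀ x ∈ F, g x = h x) : g =ᵐ[uniformMeasure F] h := by
  refine ae_iff.mpr ?_
  simp only [uniformMeasure, Measure.finsetSum_apply, Measure.smul_apply]
  refine Finset.sum_eq_zero fun x hx => ?_
  simp [hgh x hx]

theorem eLpNorm_uniformMeasure (F : Finset X) (g : X → ℂ) :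
    eLpNorm g 2 (uniformMeasure F)
      = ((F.card : ℝ≥0∞)⁻¹ * ∑ x ∈ F, ‖g x‖ₑ ^ 2) ^ (1 / 2 : ℝ) := by
  rw [eLpNorm_eq_lintegral_rpow_enorm_toReal (by simp) (by simp), lintegral_uniformMeasure]
  simp

theorem memLp_uniformMeasure {F : Finset X} (hF : F.Nonempty) (g : X → ℂ) :
    MemLp g 2 (uniformMeasure F) := by
  refine ⟨(Measurable.of_discrete (f := g)).aestronglyMeasurable, ?_⟩
  rw [eLpNorm_uniformMeasure]
  refine ENNReal.rpow_lt_top_of_nonneg (by norm_num) (ENNReal.mul_ne_top ?_ ?_)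
  · simpa using hF.ne_empty
  · exact ENNReal.sum_ne_top.mpr fun x _ => by simp

theorem norm_sq_uniformMeasure (F : Finset X) (φ : Lp ℂ 2 (uniformMeasure F)) :
    ‖φ‖ ^ 2 = (F.card : ℝ)⁻¹ * ∑ x : F, ‖φ x‖ ^ 2 := by
  rw [Lp.norm_def, eLpNorm_uniformMeasure, ← ENNReal.toReal_rpow, ← Real.sqrt_eq_rpow,
    Real.sq_sqrt ENNReal.toReal_nonneg, ENNReal.toReal_mul, ENNReal.toReal_sum (by simp),
    Finset.sum_coe_sort F (fun x => ‖φ x‖ ^ 2)]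
  simp

/-- The values of an element of `l²` of the uniform measure on `F` at the points of `F`. -/
noncomputable def restrictLp (F : Finset X) : Lp ℂ 2 (uniformMeasure F) →ₗ[ℂ] (F → ℂ) where
  toFun φ x := φ x
  map_add' φ ψ := by
    ext x
    exact eq_of_ae_uniformMeasure (Lp.coeFn_add φ ψ) x.2
  map_smul' a φ := by
    ext x
    exact eq_of_ae_uniformMeasure (Lp.coeFn_smul a φ) x.2

theorem restrictLp_apply {F : Finset X} (φ : Lp ℂ 2 (uniformMeasure F)) (x : F) :
    restrictLp F φ x = φ x := rfl

theorem restrictLp_injective (F : Finset X) : Function.Injective (restrictLp F) := by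
  intro φ ψ h
  exact Lp.ext (ae_uniformMeasure_of_forall fun x hx => congrFun h ⟨x, hx⟩)

theorem restrictLp_surjective {F : Finset X} (hF : F.Nonempty) :
    Function.Surjective (restrictLp F) := by
  classical
  intro v
  refine ⟨(memLp_uniformMeasure hF fun x => if h : x ∈ F then v ⟨x, h⟩ else 0).toLp _, ?_⟩
  ext x
  rw [restrictLp_apply, eq_of_ae_uniformMeasure (MemLp.coeFn_toLp _) x.2]
  simp

/-- `l²` of the uniform measure on `F` is the space of functions on `F`. -/
noncomputable def lpEquiv {F : Finset X} (hF : F.Nonempty) :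
    Lp ℂ 2 (uniformMeasure F) ≃ₗ[ℂ] (F → ℂ) :=
  LinearEquiv.ofBijective (restrictLp F) ⟨restrictLp_injective F, restrictLp_surjective hF⟩

theorem lpEquiv_apply {F : Finset X} (hF : F.Nonempty) (φ : Lp ℂ 2 (uniformMeasure F)) (x : F) :
    lpEquiv hF φ x = φ x := rfl

/-- The operator on `l²` of the uniform measure on `F` induced by an operator on functions. -/
noncomputable def lpOperator {F : Finset X} (hF : F.Nonempty) (A : (F → ℂ) →ₗ[ℂ] (F → ℂ)) :
    Lp ℂ 2 (uniformMeasure F) →L[ℂ] Lp ℂ 2 (uniformMeasure F) :=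
  haveI : FiniteDimensional ℂ (Lp ℂ 2 (uniformMeasure F)) :=
    FiniteDimensional.of_injective (restrictLp F) (restrictLp_injective F)
  LinearMap.toContinuousLinearMap ((lpEquiv hF).symm.toLinearMap ∘ₗ A ∘ₗ (lpEquiv hF).toLinearMap)

theorem lpEquiv_lpOperator {F : Finset X} (hF : F.Nonempty) (A : (F → ℂ) →ₗ[ℂ] (F → ℂ))
    (φ : Lp ℂ 2 (uniformMeasure F)) :
    lpEquiv hF (lpOperator hF A φ) = A (lpEquiv hF φ) := by
  simp [lpOperator]

theorem one_le_norm_lpOperator {F : Finset X} (hF : F.Nonempty) {A : (F → ℂ) →ₗ[ℂ] (F → ℂ)}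
    (hA : A (fun _ => 1) = fun _ => 1) : 1 ≤ ‖lpOperator hF A‖ := by
  set φ := (lpEquiv hF).symm (fun _ => 1) with hφ
  have hfix : lpOperator hF A φ = φ := by
    apply (lpEquiv hF).injective
    rw [lpEquiv_lpOperator, hφ, LinearEquiv.apply_symm_apply, hA]
  have hne : φ ≠ 0 := by
    intro h0
    obtain ⟨x, hx⟩ := hF
    have : lpEquiv ⟨x, hx⟩ φ = fun _ => 1 := by rw [hφ, LinearEquiv.apply_symm_apply]
    rw [h0, map_zero] at this
    simpa using congrFun this ⟨x, hx⟩
  have h := (lpOperator hF A).le_opNorm φ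
  rw [hfix] at h
  exact (le_mul_iff_one_le_left (norm_pos_iff.mpr hne)).mp h

end UniformMeasure

/-! ### ONL for operators on finite subsets -/

theorem hasPropagation_lpOperator {X : Type*} [MetricSpace X] [MeasurableSpace X]
    [DiscreteMeasurableSpace X] {F : Finset X} (hF : F.Nonempty)
    [IsProbabilityMeasure (uniformMeasure F)] {R : ℝ} {A : (F → ℂ) →ₗ[ℂ] (F → ℂ)}
    (hA : ∀ v x, A v x ≠ 0 → ∃ y, v y ≠ 0 ∧ dist x y ≤ R) :
    HasPropagation R (lpOperator hF A) := by
  intro x y hx hy hxy v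
  rw [uniformMeasure_singleton_ne_zero_iff] at hx hy
  by_contra hne
  rw [matrixEntry, ← lpEquiv_apply hF _ ⟨x, hx⟩, lpEquiv_lpOperator] at hne
  -- The input vector is concentrated at `y`, so the point `z` supplied by `hA` must be `y`.
  obtain ⟨z, hz, hxz⟩ := hA _ _ hne
  have hzy : (z : X) = y := by
    by_contra hzy
    refine hz ?_
    rw [lpEquiv_apply, single, eq_of_ae_uniformMeasure indicatorConstLp_coeFn z.2]
    exact Set.indicator_of_notMem (s := {y}) (f := fun _ => v) hzy
  rw [Subtype.dist_eq, hzy] at hxz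
  exact absurd hxz (not_le.mpr hxy)

/-- What the operator norm localisation property says about operators on functions on finite
subsets. -/
theorem ONL.exists_localised {X : Type*} [MetricSpace X] (h : ONL X) :
    ∃ c : ℝ, 0 < c ∧ ∀ R : ℝ, 0 < R → ∃ S : ℝ, 0 < S ∧ ∀ F : Finset X, F.Nonempty →
      ∀ A : (F → ℂ) →ₗ[ℂ] (F → ℂ), A (fun _ => 1) = (fun _ => 1) →
        (∀ v x, A v x ≠ 0 → ∃ y, v y ≠ 0 ∧ dist x y ≤ R) →
        ∃ v : F → ℂ, 0 < ∑ x, ‖v x‖ ^ 2 ∧ (∀ x y, v x ≠ 0 → v y ≠ 0 → dist x y ≤ S) ∧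
          c * ∑ x, ‖v x‖ ^ 2 ≤ ∑ x, ‖A v x‖ ^ 2 := by
  let _ : MeasurableSpace X := ⊤
  obtain ⟨c, hc, h⟩ := h
  -- Squared because the conclusion compares squared norms.
  refine ⟨c ^ 2, by positivity, fun R hR => ?_⟩
  obtain ⟨S, hS, h⟩ := h R hR
  refine ⟨S, hS, fun F hF A hA1 hA => ?_⟩
  have := isProbabilityMeasure_uniformMeasure hF
  obtain ⟨φ, hφ, hdiam, hle⟩ := h (uniformMeasure F) ℂ (lpOperator hF A)
    (hasPropagation_lpOperator hF hA)
  have hcard : (0 : ℝ) < (F.card : ℝ)⁻¹ := by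
    have := hF.card_pos
    positivity
  have hnorm : 1 = (F.card : ℝ)⁻¹ * ∑ x : F, ‖lpEquiv hF φ x‖ ^ 2 := by
    rw [← one_pow 2, ← hφ]
    exact norm_sq_uniformMeasure F φ
  have hTnorm : ‖lpOperator hF A φ‖ ^ 2 = (F.card : ℝ)⁻¹ * ∑ x : F, ‖A (lpEquiv hF φ) x‖ ^ 2 := by
    rw [← lpEquiv_lpOperator]
    exact norm_sq_uniformMeasure F _
  refine ⟨lpEquiv hF φ, ?_, fun x y hx hy => ?_, ?_⟩
  · by_contra h0
    have := mul_nonpos_of_nonneg_of_nonpos hcard.le (not_lt.mp h0)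
    linarith
  · have hmem : ∀ z : F, lpEquiv hF φ z ≠ 0 → (z : X) ∈ l2Support φ := fun z hz =>
      ⟨uniformMeasure_singleton_ne_zero_iff.mpr z.2, hz⟩
    have := (Metric.edist_le_ediam_of_mem (hmem x hx) (hmem y hy)).trans hdiam
    rw [edist_dist] at this
    exact (ENNReal.ofReal_le_ofReal_iff hS.le).mp this
  · have h1 : c ≤ ‖lpOperator hF A φ‖ :=
      le_trans (le_mul_of_one_le_right hc.le (one_le_norm_lpOperator hF hA1)) hle
    have h2 : c ^ 2 ≤ ‖lpOperator hF A φ‖ ^ 2 := by gcongr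
    refine le_of_mul_le_mul_left ?_ hcard
    rw [← hTnorm, mul_left_comm, ← hnorm, mul_one]
    exact h2

/-! ### Boundaries of superlevel sets -/

section LevelSets

variable {X : Type*} [MetricSpace X]

theorem mem_boundary_iff {R : ℝ} (hR : 0 ≤ R) {E : Set X} (hE : E.Finite) {x : X} :
    x ∈ boundary R E ↔ (∃ y ∈ E, dist x y ≤ R) ∧ x ∉ E := by
  simp [boundary, hE.isCompact.cthickening_eq_biUnion_closedBall hR]

/-- A boundary point `x` has `f x ≤ t` and a neighbour `y` with `t < f y`, so it contributes at
least one pair to the sum. -/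
theorem ncard_boundary_superlevel_le {R t : ℝ} (hR : 0 ≤ R) {F : Finset X} {f : X → ℝ}
    (hE : {x | t < f x} ⊆ F) :
    ((boundary R {x | t < f x} ∩ F).ncard : ℝ)
      ≤ ∑ x ∈ F, ∑ y ∈ F with dist x y ≤ R, (Set.Ico (f x) (f y)).indicator (fun _ => (1 : ℝ)) t := by
  classical
  have hfin : {x | t < f x}.Finite := F.finite_toSet.subset hE
  have hset : boundary R {x | t < f x} ∩ F
      = ((F.filter fun x => x ∈ boundary R {x | t < f x} : Finset X) : Set X) := by
    ext x
    simp [and_comm]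
  rw [hset, Set.ncard_coe_finset, Finset.card_filter]
  push_cast
  refine Finset.sum_le_sum fun x hx => ?_
  have hnonneg : ∀ y ∈ F.filter (fun y => dist x y ≤ R),
      0 ≤ (Set.Ico (f x) (f y)).indicator (fun _ => (1 : ℝ)) t :=
    fun y _ => Set.indicator_nonneg (fun _ _ => zero_le_one) _
  split_ifs with h
  · obtain ⟨⟨y, hy, hxy⟩, hx'⟩ := (mem_boundary_iff hR hfin).mp h
    have hmem : t ∈ Set.Ico (f x) (f y) := ⟨not_lt.mp hx', hy⟩
    calc (1 : ℝ) = (Set.Ico (f x) (f y)).indicator (fun _ => (1 : ℝ)) t := by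
          rw [Set.indicator_of_mem hmem]
      _ ≤ _ := Finset.single_le_sum hnonneg (Finset.mem_filter.mpr ⟨hE hy, hxy⟩)
  · exact Finset.sum_nonneg hnonneg

theorem integrable_indicator_Ico (a b : ℝ) :
    Integrable ((Set.Ico a b).indicator (fun _ => (1 : ℝ))) :=
  (integrable_indicator_iff measurableSet_Ico).mpr (by simp)

theorem integral_indicator_Ico (a b : ℝ) :
    ∫ t, (Set.Ico a b).indicator (fun _ => (1 : ℝ)) t = max (b - a) 0 := by
  rw [integral_indicator measurableSet_Ico]
  simp [Measure.real, Real.volume_Ico, ENNReal.toReal_ofReal']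

/-- The layer cake argument: if `f` varies little in the mean, then so does the indicator function
of one of its superlevel sets. -/
theorem exists_superlevel_boundary_lt {R ε : ℝ} (hR : 0 ≤ R) {F : Finset X} {f : X → ℝ}
    (hf : ∀ x, 0 ≤ f x) (hsupp : Function.support f ⊆ F)
    (h : ∑ x ∈ F, ∑ y ∈ F with dist x y ≤ R, |f x - f y| < ε * ∑ x ∈ F, f x) :
    ∃ t : ℝ, 0 ≤ t ∧ ((boundary R {x | t < f x} ∩ F).ncard : ℝ)
      < ε * (({x | t < f x} ∩ F).ncard : ℝ) := by
  classical
  by_contra! hcon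
  -- For `t < 0` the left side vanishes, so the inequality holds on the whole line and can be
  -- integrated.
  have hle : ∀ t : ℝ, ε * ∑ x ∈ F, (Set.Ico 0 (f x)).indicator (fun _ => (1 : ℝ)) t
      ≤ ∑ x ∈ F, ∑ y ∈ F with dist x y ≤ R,
          (Set.Ico (f x) (f y)).indicator (fun _ => (1 : ℝ)) t := by
    intro t
    rcases lt_or_ge t 0 with ht | ht
    · rw [Finset.sum_eq_zero, mul_zero]
      · exact Finset.sum_nonneg fun x _ => Finset.sum_nonneg fun y _ =>
          Set.indicator_nonneg (fun _ _ => zero_le_one) _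
      · intro x _
        exact Set.indicator_of_notMem (fun hm => absurd hm.1 (not_le.mpr ht)) _
    · have hE : {x | t < f x} ⊆ F := fun x hx => hsupp (ht.trans_lt hx).ne'
      refine le_trans (le_of_eq ?_) ((hcon t ht).trans (ncard_boundary_superlevel_le hR hE))
      have hset : {x | t < f x} ∩ F = ((F.filter fun x => t < f x : Finset X) : Set X) := by
        ext x
        simp [and_comm]
      rw [hset, Set.ncard_coe_finset, Finset.card_filter]
      push_cast
      congr 1
      refine Finset.sum_congr rfl fun x _ => ?_
      simp [Set.indicator_apply, ht]
  have hint := integral_mono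
    ((integrable_finsetSum F fun x _ => integrable_indicator_Ico 0 (f x)).const_mul ε)
    (integrable_finsetSum F fun x _ => integrable_finsetSum _ fun y _ =>
      integrable_indicator_Ico (f x) (f y)) hle
  rw [integral_const_mul, integral_finsetSum _ fun x _ => integrable_indicator_Ico 0 (f x),
    integral_finsetSum _ fun x _ => integrable_finsetSum _ fun y _ =>
      integrable_indicator_Ico (f x) (f y)] at hint
  simp only [integral_finsetSum _ fun y _ => integrable_indicator_Ico _ (f y),
    integral_indicator_Ico, sub_zero, max_eq_left (hf _)] at hint
  refine absurd (hint.trans (Finset.sum_le_sum fun x _ => Finset.sum_le_sum fun y _ => ?_))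
    (not_le.mpr h)
  rw [abs_sub_comm]
  exact max_le (le_abs_self _) (abs_nonneg _)

end LevelSets

/-! ### From ONL to ULA -/

theorem BoundedGeometry.exists_card_filter_le {X : Type*} [MetricSpace X]
    (hX : BoundedGeometry X) {R : ℝ} (hR : 0 < R) :
    ∃ M : ℕ, 0 < M ∧ ∀ (F : Finset X) (x : F),
      (Finset.univ.filter fun y : F => dist x y ≤ R).card ≤ M := by
  obtain ⟨N, hN⟩ := hX R hR
  refine ⟨N + 1, N.succ_pos, fun F x => Nat.le_succ_of_le ?_⟩
  have hsub : (((Finset.univ.filter fun y : F => dist x y ≤ R).map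
      (Function.Embedding.subtype _) : Finset X) : Set X) ⊆ Metric.closedBall (x : X) R := by
    intro z hz
    simp only [Finset.coe_map, Set.mem_image, Finset.mem_coe, Finset.mem_filter] at hz
    obtain ⟨y, ⟨-, hy⟩, rfl⟩ := hz
    rw [Metric.mem_closedBall, dist_comm]
    exact hy
  have h := (Set.encard_le_encard hsub).trans (hN x)
  rw [Set.encard_coe_eq_coe_finsetCard, Finset.card_map] at h
  exact_mod_cast h

/-- Almost invariant vectors for the averaging operators, with uniformly bounded supports. -/
theorem exists_energy_le {X : Type*} [MetricSpace X] (hX : BoundedGeometry X) (h : ONL X)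
    {R η : ℝ} (hR : 0 < R) (hη : 0 < η) :
    ∃ S : ℝ, 0 < S ∧ ∀ F : Finset X, F.Nonempty → ∃ v : F → ℂ, 0 < ∑ x, ‖v x‖ ^ 2 ∧
      (∀ x y, v x ≠ 0 → v y ≠ 0 → dist x y ≤ S) ∧
      energy R v ≤ η * ∑ x, ‖v x‖ ^ 2 := by
  obtain ⟨M, hM0, hM⟩ := hX.exists_card_filter_le hR
  have hM' : (0 : ℝ) < M := by exact_mod_cast hM0
  obtain ⟨c, hc, h⟩ := h.exists_localised
  -- The minimum with `1` keeps the ratio `1 - δ` nonnegative; `η / (4 * M)` turns a relative loss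
  -- into an energy bound.
  set δ : ℝ := min 1 (η / (4 * M)) with hδ
  have hδ0 : 0 < δ := lt_min one_pos (by positivity)
  have hδ1 : δ ≤ 1 := min_le_left _ _
  obtain ⟨n, hn⟩ := exists_pow_lt_of_lt_one hc (by linarith : 1 - δ < 1)
  -- `n + 1` rather than `n` keeps the propagation bound positive when `n = 0`.
  obtain ⟨S, hS, h⟩ := h ((n + 1 : ℝ) * R) (by positivity)
  refine ⟨S + 2 * ((n : ℝ) * R), by positivity, fun F hF => ?_⟩
  obtain ⟨v, hv, hdiam, hle⟩ := h F hF (averaging R (2 * M) ^ n) (averaging_pow_const _ _ _)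
    (fun v x hx => by
      obtain ⟨y, hy, hxy⟩ := exists_of_averaging_pow_ne_zero hR.le n hx
      exact ⟨y, hy, hxy.trans (by nlinarith)⟩)
  obtain ⟨k, hk, hlt⟩ := exists_lt_of_pow_lt
    (a := fun k => ∑ x, ‖(averaging R (2 * M) ^ k) v x‖ ^ 2) (by linarith) hn hv hle
  set ψ := (averaging R (2 * M) ^ k) v with hψ
  simp only [pow_succ' (averaging R (2 * (M : ℝ))), Module.End.mul_apply, ← hψ] at hlt
  have hupper := sum_norm_sq_averaging_le hM0 (hM F) ψ
  have hen := energy_nonneg R ψ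
  refine ⟨ψ, ?_, fun x y hx hy => ?_, ?_⟩
  -- If `ψ` vanished, the strict inequality `hlt` would contradict `hupper`.
  · refine (Finset.sum_nonneg fun x _ => sq_nonneg _).lt_of_ne fun h0 => ?_
    rw [← h0] at hlt hupper
    have : 0 ≤ energy R ψ / (4 * M) := by positivity
    linarith
  · obtain ⟨x', hx', hxx'⟩ := exists_of_averaging_pow_ne_zero hR.le k hx
    obtain ⟨y', hy', hyy'⟩ := exists_of_averaging_pow_ne_zero hR.le k hy
    have h1 := dist_triangle4 x x' y' y
    have h2 := hdiam x' y' hx' hy'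
    have h3 : (k : ℝ) * R ≤ n * R := by gcongr
    rw [dist_comm y y'] at hyy'
    linarith
  · have h1 : energy R ψ / (4 * M) ≤ δ * ∑ x, ‖ψ x‖ ^ 2 := by linarith
    have h2 : δ * ∑ x, ‖ψ x‖ ^ 2 ≤ η / (4 * M) * ∑ x, ‖ψ x‖ ^ 2 := by
      gcongr
      exact min_le_right _ _
    have h3 := h1.trans h2
    rw [div_mul_eq_mul_div] at h3
    exact (div_le_div_iff_of_pos_right (by positivity)).mp h3

theorem exists_variation_lt {X : Type*} [MetricSpace X] (hX : BoundedGeometry X) (h : ONL X)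
    {R ε : ℝ} (hR : 0 < R) (hε : 0 < ε) :
    ∃ S : ℝ, 0 < S ∧ ∀ F : Finset X, F.Nonempty → ∃ f : X → ℝ, (∀ x, 0 ≤ f x) ∧
      Function.support f ⊆ F ∧ Metric.ediam (Function.support f) ≤ ENNReal.ofReal S ∧
      ∑ x ∈ F, ∑ y ∈ F with dist x y ≤ R, |f x - f y| < ε * ∑ x ∈ F, f x := by
  classical
  obtain ⟨M, hM0, hM⟩ := hX.exists_card_filter_le hR
  have hM' : (0 : ℝ) < M := by exact_mod_cast hM0
  -- With `t = ε / (8 * M)` below, this `η` makes both terms of `sum_abs_norm_sq_sub_le` at most `ε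
  -- / 4` times the squared norm.
  obtain ⟨S, hS, h⟩ := exists_energy_le hX h hR (η := ε ^ 2 / (16 * M)) (by positivity)
  refine ⟨S, hS, fun F hF => ?_⟩
  obtain ⟨v, hv, hdiam, hen⟩ := h F hF
  set f : X → ℝ := fun x => if hx : x ∈ F then ‖v ⟨x, hx⟩‖ ^ 2 else 0 with hf
  have hfF : ∀ x : F, f x = ‖v x‖ ^ 2 := fun x => by simp [hf]
  have hsupp : ∀ x, f x ≠ 0 → ∃ hx : x ∈ F, v ⟨x, hx⟩ ≠ 0 := by
    intro x hx
    by_cases hxF : x ∈ F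
    · refine ⟨hxF, fun h0 => hx ?_⟩
      simp [hf, h0]
    · exact absurd (by simp [hf, hxF]) hx
  refine ⟨f, fun x => ?_, fun x hx => (hsupp x hx).1, ?_, ?_⟩
  · simp only [hf]
    split_ifs <;> positivity
  · refine Metric.ediam_le fun x hx y hy => ?_
    obtain ⟨hxF, hvx⟩ := hsupp x hx
    obtain ⟨hyF, hvy⟩ := hsupp y hy
    rw [edist_dist]
    exact ENNReal.ofReal_le_ofReal (hdiam _ _ hvx hvy)
  · have hvar := sum_abs_norm_sq_sub_le (t := ε / (8 * M)) (by positivity) (hM F) v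
    have h1 : energy R v / (2 * (ε / (8 * M))) ≤ ε / 4 * ∑ x, ‖v x‖ ^ 2 := by
      rw [div_le_iff₀ (by positivity)]
      refine hen.trans (le_of_eq ?_)
      field_simp
      ring
    have h2 : 2 * (ε / (8 * M)) * M = ε / 4 := by
      field_simp
      ring
    rw [h2] at hvar
    have hsum : ∑ x ∈ F, f x = ∑ x, ‖v x‖ ^ 2 := by
      rw [← Finset.sum_coe_sort F f]
      exact Finset.sum_congr rfl fun x _ => hfF x
    have hsum2 : ∑ x ∈ F, ∑ y ∈ F with dist x y ≤ R, |f x - f y|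
        = ∑ x : F, ∑ y : F with dist x y ≤ R, |‖v x‖ ^ 2 - ‖v y‖ ^ 2| := by
      simp only [Finset.sum_filter]
      rw [← Finset.sum_coe_sort F]
      refine Finset.sum_congr rfl fun x _ => ?_
      rw [← Finset.sum_coe_sort F]
      refine Finset.sum_congr rfl fun y _ => ?_
      rw [hfF, hfF, Subtype.dist_eq]
    rw [hsum, hsum2]
    have h3 : 0 < ε * ∑ x, ‖v x‖ ^ 2 := mul_pos hε hv
    linarith

theorem ulaFunction_of_onl {X : Type*} [MetricSpace X] (hX : BoundedGeometry X) (h : ONL X) :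
    ULAFunction X := by
  intro R ε hR hε
  obtain ⟨S, hS, h⟩ := exists_variation_lt hX h hR hε
  refine ⟨S, hS, fun F hF => ?_⟩
  obtain ⟨f, hf, hsupp, hdiam, hlt⟩ := h F hF
  have hmem : Memℓp f 1 :=
    (memℓp_zero (F.finite_toSet.subset hsupp)).of_exponent_ge zero_le_one
  refine ⟨⟨f, hmem⟩, hdiam, ?_⟩
  simpa only [abs_of_nonneg (hf _)] using hlt

theorem ulaSet_of_onl {X : Type*} [MetricSpace X] (hX : BoundedGeometry X) (h : ONL X) :
    ULASet X := by
  intro R ε hR hε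
  obtain ⟨S, hS, h⟩ := exists_variation_lt hX h hR hε
  refine ⟨S, hS, fun F hF => ?_⟩
  obtain ⟨f, hf, hsupp, hdiam, hlt⟩ := h F hF
  obtain ⟨t, ht, hE⟩ := exists_superlevel_boundary_lt hR.le hf hsupp hlt
  have hsub : {x | t < f x} ⊆ Function.support f := fun x hx => (ht.trans_lt hx).ne'
  exact ⟨_, F.finite_toSet.subset (hsub.trans hsupp), (Metric.ediam_mono hsub).trans hdiam, hE⟩

end CoarseGeometry

theorem mainTheorem4 {X : Type*} [MetricSpace X] (hX : CoarseGeometry.BoundedGeometry X)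
    (hONL : CoarseGeometry.ONL X) : CoarseGeometry.ULA X :=
  ⟨CoarseGeometry.ulaFunction_of_onl hX hONL, CoarseGeometry.ulaSet_of_onl hX hONL⟩
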